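/- Let $K$ be a field and let $\mathcal G=\langle \mathbf g_1,\dots,\mathbf g_n\rangle$ and $\mathcal F=\langle \mathbf f_1,\dots,\mathbf f_n\rangle$ be abelian groups with distinguished generators, each grading $K[x_1,\dots,x_n]$ by giving $x_i$ the degree $\mathbf g_i$, respectively $\mathbf f_i$. For vectors $\mathbf h_1,\dots,\mathbf h_n$ in an abelian group $\mathcal H$ let $L_{\mathcal H}=\{u\in\mathbb Z^n:\sum_i u_i\mathbf h_i=0\}$ be their lattice of relations. Assume that the $\mathcal G$-grading is positive, i.e. $L_{\mathcal G}\cap\mathbb N^n=\{0\}$, and that $\mathcal F\le\mathcal G$, i.e. every $\mathcal G$-homogeneous ideal of $K[x_1,\dots,x_n]$ (one generated by $\mathcal G$-homogeneous polynomials) is $\mathcal F$-homogeneous. Let $I_{L_{\mathcal G}}=(x^{\alpha_+}-x^{\alpha_-}:\alpha\in L_{\mathcal G})$ be the lattice ideal. For a lattice $L\subset\mathbb Z^n$ let $\mathrm{Sat}(L)=\{\alpha\in\mathbb Z^n: d\alpha\in L\text{ for some } d\in\mathbb Z\setminus\{0\}\}$. Choose vectors $\mathbf a_1,\dots,\mathbf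 a_n\in\mathbb Z^m$ and $\mathbf b_1,\dots,\mathbf b_n\in\mathbb Z^q$ whose lattices of relations are $\mathrm{Sat}(L_{\mathcal G})$ and $\mathrm{Sat}(L_{\mathcal F})$, respectively. Let $\sigma=\mathrm{pos}_{\mathbb Q}(\mathbf a_1,\dots,\mathbf a_n)$, let $\mathbf r_1,\dots,\mathbf r_t$ be integer vectors, one on each extreme ray of $\sigma$, and let $\pi$ be the linear projection of $\sigma$ onto $\mathrm{pos}_{\mathbb Q}(\mathbf b_1,\dots,\mathbf b_n)$ with $\pi(\mathbf a_i)=\mathbf b_i$. For $E\subset\{1,\dots,t\}$ put $\sigma(E)=\mathrm{pos}_{\mathbb Q}(\mathbf r_j: j\in E)$, and let $\mathbb E_1,\dots,\mathbb E_l$ be the sets $E$ for which $\sigma(E)$ is minimal, under inclusion, among those cones $\sigma(E)$ that are not faces of $\sigma$. Let $\mathcal D_{\mathcal F}^{\mathcal G}$ be the simplicial complex with vertices $\mathbb E_1,\dots,\mathbb E_l$ in which a nonempty set $T$ of vertices is a simplex if and only if $\bigcap_{\mathbb E_i\in T}\mathrm{relint}_{\mathbb Q}(\pi(\sigma(\mathbb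 E_i)))\ne\emptyset$; $\mathcal D_{\mathcal G}^{\mathcal G}$ is the case $\mathcal F=\mathcal G$, $\pi=\mathrm{id}$. For a finite simplicial complex $\mathcal D$, a matching is a set of pairwise disjoint simplices, a matching is maximal if the union of its simplices has the maximum possible number of vertices, and $\delta(\mathcal D)_\Omega$ is the minimum cardinality of a maximal matching. If $F_1,\dots,F_s\in K[x_1,\dots,x_n]$ satisfy $\mathrm{rad}(F_1,\dots,F_s)=\mathrm{rad}(I_{L_{\mathcal G}})$, then 1. the number of distinct monomials that appear with nonzero coefficient in at least one of $F_1,\dots,F_s$ (and hence also the number counted separately for each $F_i$ and summed) is at least the number of vertices of $\mathcal D_{\mathcal G}^{\mathcal G}$; and 2. the sum over $i=1,\dots,s$ of the number of nonzero $\mathcal F$-homogeneous components of $F_i$ is at least $\delta(\mathcal D_{\mathcal F}^{\mathcal G})_\Omega$. -/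

import Mathlib

open MvPolynomial

noncomputable section

namespace LatticeIdeal

/-! ### Gradings and lattice ideals -/

/-- The degree map `ℤⁿ → M`, `u ↦ u₁ g₁ + ⋯ + uₙ gₙ`. -/
def degMap {n : ℕ} {M : Type*} [AddCommGroup M] (g : Fin n → M) : (Fin n → ℤ) →ₗ[ℤ] M :=
  Fintype.linearCombination ℤ g

/-- The lattice of integer relations of `g₁, …, gₙ`. -/
def relationLattice {n : ℕ} {M : Type*} [AddCommGroup M] (g : Fin n → M) :
    Submodule ℤ (Fin n → ℤ) :=
  LinearMap.ker (degMap g)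

/-- The saturation `{α : d α ∈ L for some nonzero integer d}`. -/
def saturation {n : ℕ} (L : Submodule ℤ (Fin n → ℤ)) : Set (Fin n → ℤ) :=
  {α | ∃ d : ℤ, d ≠ 0 ∧ d • α ∈ L}

/-- The positive part of `α`, as an exponent vector; the negative part is that of `-α`. -/
def posPart {n : ℕ} (α : Fin n → ℤ) : Fin n →₀ ℕ :=
  Finsupp.equivFunOnFinite.symm fun i => (α i).toNat

/-- The lattice ideal `(x^{α₊} - x^{α₋} : α ∈ L)` of `K[x₁, …, xₙ]`. -/
def latticeIdeal (K : Type*) [Field K] {n : ℕ} (L : Submodule ℤ (Fin n → ℤ)) :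
    Ideal (MvPolynomial (Fin n) K) :=
  Ideal.span {P | ∃ α ∈ L, P = monomial (posPart α) 1 - monomial (posPart (-α)) 1}

/-- All monomials of `P` have the same degree. -/
def IsHomogeneousPoly {K : Type*} [Field K] {n : ℕ} {M : Type*} [AddCommGroup M]
    (g : Fin n → M) (P : MvPolynomial (Fin n) K) : Prop :=
  ∃ d : M, IsWeightedHomogeneous g P d

/-- The ideal `J` is generated by homogeneous polynomials. -/
def IsHomogeneousIdeal {K : Type*} [Field K] {n : ℕ} {M : Type*} [AddCommGroup M]
    (g : Fin n → M) (J : Ideal (MvPolynomial (Fin n) K)) : Prop :=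
  ∃ S : Set (MvPolynomial (Fin n) K), (∀ P ∈ S, IsHomogeneousPoly g P) ∧ J = Ideal.span S

/-- The grading by `f` is a specialization of the grading by `g`. -/
def IsSpecialization (K : Type*) [Field K] {n : ℕ} {M N : Type*} [AddCommGroup M]
    [AddCommGroup N] (f : Fin n → M) (g : Fin n → N) : Prop :=
  ∀ J : Ideal (MvPolynomial (Fin n) K), IsHomogeneousIdeal g J → IsHomogeneousIdeal f J

/-- The grading is positive: `L ∩ ℕⁿ = {0}`. -/
def IsPositiveGrading {n : ℕ} {M : Type*} [AddCommGroup M] (g : Fin n → M) : Prop :=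
  ∀ u ∈ relationLattice g, (∀ i, 0 ≤ u i) → u = 0

/-- The number of nonzero homogeneous components of `P`. -/
def numComponents {K : Type*} [Field K] {n : ℕ} {M : Type*} [AddCommGroup M]
    (f : Fin n → M) (P : MvPolynomial (Fin n) K) : ℕ :=
  {d : M | weightedHomogeneousComponent f d P ≠ 0}.ncard

/-! ### Rational cones -/

/-- An integer vector as a rational vector. -/
def toRat {m : ℕ} (v : Fin m → ℤ) : Fin m → ℚ := fun i => (v i : ℚ)

/-- The cone `pos_ℚ(vᵢ : i ∈ s)`. -/
def posCone {ι : Type*} {m : ℕ} (s : Finset ι) (v : ι → Fin m → ℚ) : Set (Fin m → ℚ) :=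
  {x | ∃ d : ι → ℚ, (∀ i ∈ s, 0 ≤ d i) ∧ x = ∑ i ∈ s, d i • v i}

/-- The relative interior of `pos_ℚ(vᵢ : i ∈ s)`: all combinations of the generators with
positive rational coefficients. -/
def relintCone {ι : Type*} {m : ℕ} (s : Finset ι) (v : ι → Fin m → ℚ) : Set (Fin m → ℚ) :=
  {x | ∃ d : ι → ℚ, (∀ i ∈ s, 0 < d i) ∧ x = ∑ i ∈ s, d i • v i}

/-- `T` is a face of the cone `C`. -/
def IsFace {m : ℕ} (C T : Set (Fin m → ℚ)) : Prop :=
  ∃ c : Fin m → ℚ, (∀ x ∈ C, 0 ≤ c ⬝ᵥ x) ∧ T = {x ∈ C | c ⬝ᵥ x = 0}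

/-- `T` is an extreme ray, that is, a one-dimensional face, of the cone `C`. -/
def IsExtremeRay {m : ℕ} (C T : Set (Fin m → ℚ)) : Prop :=
  IsFace C T ∧ Module.finrank ℚ (Submodule.span ℚ T) = 1

/-- The cone `σ = pos_ℚ(a₁, …, aₙ)`. -/
def sigma {n m : ℕ} (A : Fin n → Fin m → ℤ) : Set (Fin m → ℚ) :=
  posCone Finset.univ fun i => toRat (A i)

/-- `r₁, …, r_t` are extreme vectors of `σ`: integer vectors, exactly one on each extreme ray. -/
def IsExtremeVectors {n m t : ℕ} (A : Fin n → Fin m → ℤ) (r : Fin t → Fin m → ℤ) : Prop :=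
  (∀ j, IsExtremeRay (sigma A) (posCone {j} fun k => toRat (r k))) ∧
    ∀ T, IsExtremeRay (sigma A) T → ∃! j, T = posCone {j} fun k => toRat (r k)

/-- The subcone `σ(E) = pos_ℚ(rⱼ : j ∈ E)`. -/
def subcone {m t : ℕ} (r : Fin t → Fin m → ℤ) (E : Finset (Fin t)) : Set (Fin m → ℚ) :=
  posCone E fun j => toRat (r j)

/-- `σ(E)` is minimal among the subcones of `σ` that are not faces of `σ`. -/
def IsMinimalNonFace {n m t : ℕ} (A : Fin n → Fin m → ℤ) (r : Fin t → Fin m → ℤ)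
    (E : Finset (Fin t)) : Prop :=
  ¬ IsFace (sigma A) (subcone r E) ∧
    ∀ E' : Finset (Fin t), ¬ IsFace (sigma A) (subcone r E') →
      subcone r E' ⊆ subcone r E → subcone r E' = subcone r E

open Classical in
/-- The projection of cones `π : σ_A → σ_B`, `π(aᵢ) = bᵢ`, given by a linear map of the ambient
spaces. Such a map exists as soon as every relation of `A` is a relation of `B`, and its values on
`σ_A` are then determined. -/
def coneProjection {n m q : ℕ} (A : Fin n → Fin m → ℤ) (B : Fin n → Fin q → ℤ) :
    (Fin m → ℚ) →ₗ[ℚ] (Fin q → ℚ) :=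
  if h : ∃ p : (Fin m → ℚ) →ₗ[ℚ] (Fin q → ℚ), ∀ i, p (toRat (A i)) = toRat (B i)
  then h.choose else 0

theorem toRat_sum {n m : ℕ} (A : Fin n → Fin m → ℤ) (z : Fin n → ℤ) :
    ∑ i, (z i : ℚ) • toRat (A i) = toRat (degMap A z) := by
  ext k
  simp [degMap, Fintype.linearCombination_apply, toRat, Finset.sum_apply]

theorem coneProjection_apply {n m q : ℕ} (A : Fin n → Fin m → ℤ) (B : Fin n → Fin q → ℤ)
    (h : relationLattice A ≤ relationLattice B) (i : Fin n) :
    coneProjection A B (toRat (A i)) = toRat (B i) := by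
  have key : ∃ p : (Fin m → ℚ) →ₗ[ℚ] (Fin q → ℚ), ∀ i, p (toRat (A i)) = toRat (B i) := by
    let α := Fintype.linearCombination ℚ fun i => toRat (A i)
    let β := Fintype.linearCombination ℚ fun i => toRat (B i)
    have hker : LinearMap.ker α ≤ LinearMap.ker β := by
      intro d hd
      obtain ⟨⟨N, hN⟩, hz⟩ := IsLocalization.exist_integer_multiples_of_finset
        (nonZeroDivisors ℤ) (Finset.univ.image d)
      have hN0 : (N : ℚ) ≠ 0 := by exact_mod_cast nonZeroDivisors.ne_zero hN
      have hz' : ∀ i, ∃ z : ℤ, (z : ℚ) = (N : ℚ) * d i := by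
        intro i
        obtain ⟨z, hz⟩ := hz (d i) (by simp)
        exact ⟨z, by simpa using hz⟩
      choose z hz using hz'
      have scale : ∀ {l : ℕ} (C : Fin n → Fin l → ℤ),
          toRat (degMap C z) = (N : ℚ) • Fintype.linearCombination ℚ (fun i => toRat (C i)) d := by
        intro l C
        rw [← toRat_sum, Fintype.linearCombination_apply, Finset.smul_sum]
        exact Finset.sum_congr rfl fun i _ => by rw [hz, mul_smul]
      have hA : z ∈ relationLattice A := by
        have h1 := scale A
        rw [show Fintype.linearCombination ℚ (fun i => toRat (A i)) d = 0 from hd, smul_zero] at h1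
        rw [relationLattice, LinearMap.mem_ker]
        ext k
        have := congrFun h1 k
        simpa [toRat] using this
      have hB : degMap B z = 0 := h hA
      have h2 := scale B
      rw [hB] at h2
      have h3 : (N : ℚ) • Fintype.linearCombination ℚ (fun i => toRat (B i)) d = 0 := by
        rw [← h2]; ext k; simp [toRat]
      exact (smul_eq_zero.mp h3).resolve_left hN0
    obtain ⟨p, hp⟩ := LinearMap.exists_extend
      (((LinearMap.ker α).liftQ β hker).comp α.quotKerEquivRange.symm.toLinearMap)
    refine ⟨p, fun i => ?_⟩
    have hα : α (Pi.single i 1) = toRat (A i) := by simp [α, Fintype.linearCombination_apply]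
    have hβ : β (Pi.single i 1) = toRat (B i) := by simp [β, Fintype.linearCombination_apply]
    have h1 := LinearMap.congr_fun hp ⟨α (Pi.single i 1), LinearMap.mem_range_self _ _⟩
    have h2 : α.quotKerEquivRange.symm ⟨α (Pi.single i 1), LinearMap.mem_range_self _ _⟩
        = (LinearMap.ker α).mkQ (Pi.single i 1) := by
      rw [LinearEquiv.symm_apply_eq]; rfl
    simp only [LinearMap.comp_apply, LinearEquiv.coe_coe, h2] at h1
    rw [← hα, ← hβ]
    simpa using h1
  rw [coneProjection, dif_pos key]
  exact key.choose_spec i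

/-! ### Simplicial complexes -/

/-- The set of vertices of a simplicial complex. -/
def vertices {V : Type*} (D : PreAbstractSimplicialComplex V) : Set V :=
  {v | {v} ∈ D.faces}

/-- A set of pairwise disjoint simplices of `D`. -/
def IsMatching {V : Type*} (D : PreAbstractSimplicialComplex V) (M : Finset (Finset V)) : Prop :=
  (∀ T ∈ M, T ∈ D.faces) ∧ (M : Set (Finset V)).PairwiseDisjoint id

/-- A matching whose support has the maximum possible cardinality. -/
def IsMaximalMatching {V : Type*} [DecidableEq V] (D : PreAbstractSimplicialComplex V)
    (M : Finset (Finset V)) : Prop :=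
  IsMatching D M ∧
    ∀ M' : Finset (Finset V), IsMatching D M' → (M'.biUnion id).card ≤ (M.biUnion id).card

/-- The minimum cardinality `δ(D)_Ω` of a maximal matching; as `V` is finite, there is one. -/
def delta {V : Type*} [Fintype V] [DecidableEq V] (D : PreAbstractSimplicialComplex V) : ℕ :=
  sInf {k | ∃ M : Finset (Finset V), IsMaximalMatching D M ∧ M.card = k}

/-- The simplicial complex attached to the cones `σ_A` and `σ_B` and the extreme vectors `r` of
`σ_A`. Its vertices are the sets `E` for which `σ(E)` is a minimal non-face of `σ_A`; a nonempty set
`T` of them is a simplex if the relative interiors of the cones `π(σ(E)) = pos_ℚ(π(rⱼ) : j ∈ E)`,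
`E ∈ T`, have a common point. -/
def complexD {n m q t : ℕ} (A : Fin n → Fin m → ℤ) (B : Fin n → Fin q → ℤ)
    (r : Fin t → Fin m → ℤ) : PreAbstractSimplicialComplex (Finset (Fin t)) where
  faces := {T | T.Nonempty ∧ (∀ E ∈ T, IsMinimalNonFace A r E) ∧
    (⋂ E ∈ T, relintCone E fun j => coneProjection A B (toRat (r j))).Nonempty}
  isRelLowerSet_faces := by
    rintro T ⟨h1, h2, x, hx⟩
    refine ⟨h1, fun T' hT' hn => ⟨hn, fun E hE => h2 E (hT' hE), x, ?_⟩⟩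
    simp only [Set.mem_iInter] at hx ⊢
    exact fun E hE => hx E (hT' hE)

theorem vertices_complexD {n m q t : ℕ} (A : Fin n → Fin m → ℤ) (B : Fin n → Fin q → ℤ)
    (r : Fin t → Fin m → ℤ) : vertices (complexD A B r) = {E | IsMinimalNonFace A r E} := by
  ext E
  constructor
  · intro h
    exact h.2.1 E (by simp)
  · intro h
    refine ⟨by simp, by simpa using h, ?_⟩
    simp only [Finset.mem_singleton, Set.iInter_iInter_eq_left]
    exact ⟨_, fun _ => 1, by simp, rfl⟩

end LatticeIdeal

end

/-!
A face `T` of `σ` gives a common zero of the lattice ideal: set `xᵢ = 1` if `aᵢ ∈ T` and `xᵢ = 0`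
otherwise. If `σ(E)` is a minimal non-face, then its proper faces `σ(E \ {j})`, `j ∈ E`, and all
their intersections are faces of `σ`, whereas the indicator point of their union is not a zero of
the lattice ideal. So every `P i` vanishes at the former points and some `P i` does not vanish at
the latter. By inclusion–exclusion over the sets of monomials that survive at these points, `P i`
has a monomial in the variables of the boundary of `σ(E)` which does not live on a single proper
face; its degree lies in the relative interior of `σ(E)`.

Such an interior monomial determines `E`, which gives the bound on the number of monomials. If the
interior monomials of several sets `E` have the same `ℱ`-degree, then the image of that degree lies
in the relative interior of every `π(σ(E))`, so these sets form a simplex. Hence the nonzero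
`ℱ`-components of the `P i` define a cover of the vertices by simplices, which shrinks to a maximal
matching.
-/

namespace LatticeIdeal

section OrderedField

variable {𝕜 V ι : Type*} [Field 𝕜] [LinearOrder 𝕜] [IsStrictOrderedRing 𝕜] [AddCommGroup V]
  [Module 𝕜 V]

theorem mem_hull_image_finset {s : Finset ι} {v : ι → V} {x : V} :
    x ∈ PointedCone.hull 𝕜 (v '' s) ↔
      ∃ d : ι → 𝕜, (∀ i ∈ s, 0 ≤ d i) ∧ x = ∑ i ∈ s, d i • v i := by
  constructor
  · intro hx
    obtain ⟨d, rfl⟩ := (Submodule.mem_span_image_finset_iff_exists_fun' _).mp hx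
    exact ⟨fun i => d i, fun i _ => (d i).2, rfl⟩
  · rintro ⟨d, hd, rfl⟩
    exact sum_mem fun i hi =>
      PointedCone.smul_mem _ (hd i hi) (PointedCone.subset_hull (Set.mem_image_of_mem v hi))

theorem nonneg_of_mem_hull {s : Set V} {c : Module.Dual 𝕜 V} (hc : ∀ x ∈ s, 0 ≤ c x) {x : V}
    (hx : x ∈ PointedCone.hull 𝕜 s) : 0 ≤ c x := by
  have h : PointedCone.hull 𝕜 s ≤ (PointedCone.positive 𝕜 𝕜).comap c := Submodule.span_le.mpr hc
  exact h hx

theorem farkas {s : Set ι} (hs : s.Finite) (v : ι → V) {b : V}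
    (h : ∀ c : Module.Dual 𝕜 V, (∀ i ∈ s, 0 ≤ c (v i)) → 0 ≤ c b) :
    b ∈ PointedCone.hull 𝕜 (v '' s) := by
  induction s, hs using Set.Finite.induction_on generalizing v b with
  | empty =>
    have hb : b = 0 := (Module.forall_dual_apply_eq_zero_iff 𝕜 b).mp fun c =>
      le_antisymm (by simpa using h (-c) (by simp)) (h c (by simp))
    exact hb ▸ zero_mem _
  | @insert k s _ _ ih =>
    have hle : PointedCone.hull 𝕜 (v '' s) ≤ PointedCone.hull 𝕜 (v '' insert k s) :=
      Submodule.span_mono (Set.image_mono (Set.subset_insert k s))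
    by_cases hb : ∀ c : Module.Dual 𝕜 V, (∀ i ∈ s, 0 ≤ c (v i)) → 0 ≤ c b
    · exact hle (ih v hb)
    obtain ⟨y, hy, hyb, hyk⟩ : ∃ y : Module.Dual 𝕜 V, (∀ i ∈ s, 0 ≤ y (v i)) ∧ y b < 0 ∧
        y (v k) = -1 := by
      push Not at hb
      obtain ⟨x, hx, hxb⟩ := hb
      have hxk : x (v k) < 0 := by
        by_contra! hxk
        exact hxb.not_ge (h x (by simpa using ⟨hxk, hx⟩))
      have hscale : 0 < (-x (v k))⁻¹ := inv_pos.mpr (neg_pos.mpr hxk)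
      exact ⟨(-x (v k))⁻¹ • x, fun i hi => mul_nonneg hscale.le (hx i hi),
        mul_neg_of_pos_of_neg hscale hxb, by simp [hxk.ne, inv_neg]⟩
    -- Project along `v k` onto the hyperplane `y = 0`.
    let p : V →ₗ[𝕜] V := LinearMap.id + y.smulRight (v k)
    have hp (u : V) : p u = u + y u • v k := rfl
    have hpb : p b ∈ PointedCone.hull 𝕜 ((p ∘ v) '' s) := ih (p ∘ v) fun c hc =>
      h (c ∘ₗ p) (by simpa [hp, hyk] using hc)
    rw [Set.image_comp] at hpb
    obtain ⟨u, hu, hub⟩ : ∃ u ∈ PointedCone.hull 𝕜 (v '' s), p u = p b := by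
      rwa [← PointedCone.mem_map, PointedCone.map, PointedCone.hull, Submodule.map_span]
    have hbu : b = u + (y u - y b) • v k := by
      rw [hp, hp] at hub
      rw [sub_smul, ← add_sub_assoc, hub, add_sub_cancel_right]
    rw [hbu]
    exact add_mem (hle hu) (PointedCone.smul_mem _
      (sub_nonneg.mpr (hyb.le.trans (nonneg_of_mem_hull (by simpa using hy) hu)))
      (PointedCone.subset_hull ⟨k, Set.mem_insert k s, rfl⟩))

/-- The smallest face of the cone `C` that contains the point `x` of `C`. -/
def minFace (C : PointedCone 𝕜 V) (x : V) : PointedCone 𝕜 V where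
  carrier := {y | y ∈ C ∧ ∃ b : 𝕜, 0 ≤ b ∧ b • x - y ∈ C}
  zero_mem' := ⟨zero_mem C, 0, le_rfl, by simp⟩
  add_mem' := by
    rintro y z ⟨hy, b, hb, hby⟩ ⟨hz, b', hb', hbz⟩
    refine ⟨add_mem hy hz, b + b', add_nonneg hb hb', ?_⟩
    rw [add_smul, add_sub_add_comm]
    exact add_mem hby hbz
  smul_mem' := by
    rintro a y ⟨hy, b, hb, hby⟩
    refine ⟨PointedCone.smul_mem C a.2 hy, a * b, mul_nonneg a.2 hb, ?_⟩
    have h := PointedCone.smul_mem C a.2 hby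
    rwa [smul_sub, smul_smul] at h

theorem minFace_le (C : PointedCone 𝕜 V) (x : V) : minFace C x ≤ C := fun _ hy => hy.1

theorem self_mem_minFace {C : PointedCone 𝕜 V} {x : V} (hx : x ∈ C) : x ∈ minFace C x :=
  ⟨hx, 1, zero_le_one, by simp⟩

theorem isFaceOf_minFace (C : PointedCone 𝕜 V) (x : V) : (minFace C x).IsFaceOf C where
  le := minFace_le C x
  mem_of_smul_add_mem := by
    rintro y z a hy hz ha ⟨-, b, hb, hbyz⟩
    refine ⟨hy, a⁻¹ * b, mul_nonneg (inv_nonneg.mpr ha.le) hb, ?_⟩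
    have h := PointedCone.smul_mem C (inv_nonneg.mpr ha.le) (add_mem hbyz hz)
    rwa [← sub_sub, sub_add_cancel, smul_sub, smul_smul, inv_smul_smul₀ ha.ne'] at h

theorem mem_minFace_sum {C : PointedCone 𝕜 V} {s : Finset ι} {v : ι → V} (hv : ∀ i ∈ s, v i ∈ C)
    {i : ι} (hi : i ∈ s) : v i ∈ minFace C (∑ i ∈ s, v i) := by
  classical
  refine ⟨hv i hi, 1, zero_le_one, ?_⟩
  rw [one_smul, ← Finset.add_sum_erase s v hi, add_sub_cancel_left]
  exact sum_mem fun k hk => hv k (Finset.mem_of_mem_erase hk)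

theorem minFace_le_of_isFaceOf {C F : PointedCone 𝕜 V} (hF : F.IsFaceOf C) {x : V} (hx : x ∈ F) :
    minFace C x ≤ F := by
  rintro y ⟨hy, b, hb, hby⟩
  refine hF.mem_of_add_mem_left hy hby ?_
  rw [add_sub_cancel]
  exact PointedCone.smul_mem F hb hx

theorem mem_face_of_sum_smul_mem {C F : PointedCone 𝕜 V} (hF : F.IsFaceOf C) {s : Finset ι}
    {d : ι → 𝕜} {v : ι → V} (hv : ∀ i ∈ s, v i ∈ C) (hd : ∀ i ∈ s, 0 ≤ d i)
    (h : ∑ i ∈ s, d i • v i ∈ F) {i : ι} (hi : i ∈ s) (hdi : 0 < d i) : v i ∈ F := by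
  rw [← Finset.sum_coe_sort s] at h
  exact hF.mem_of_sum_smul_mem (f := fun i : s => v i) (fun i => hv i i.2) (fun i => hd i i.2) h
    ⟨i, hi⟩ hdi

theorem weight_mem_face_iff {C F : PointedCone 𝕜 V} (hF : F.IsFaceOf C) {v : ι → V}
    (hv : ∀ i, v i ∈ C) (w : ι →₀ ℕ) :
    Finsupp.weight v w ∈ F ↔ ∀ i ∈ w.support, v i ∈ F := by
  rw [Finsupp.weight_apply, Finsupp.sum]
  refine ⟨fun h i hi => ?_, fun h => sum_mem fun i hi => nsmul_mem (h i hi) _⟩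
  simp only [← Nat.cast_smul_eq_nsmul 𝕜] at h
  exact mem_face_of_sum_smul_mem hF (fun i _ => hv i) (fun i _ => Nat.cast_nonneg _) h hi
    (Nat.cast_pos.mpr (Nat.pos_of_ne_zero (Finsupp.mem_support_iff.mp hi)))

theorem minFace_hull_le {s : Set V} {x : V} {D : PointedCone 𝕜 V}
    (h : ∀ y ∈ s, y ∈ minFace (PointedCone.hull 𝕜 s) x → y ∈ D) :
    minFace (PointedCone.hull 𝕜 s) x ≤ D := by
  have hface := isFaceOf_minFace (PointedCone.hull 𝕜 s) x
  intro y hy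
  refine Submodule.span_induction (p := fun y _ => y ∈ minFace (PointedCone.hull 𝕜 s) x → y ∈ D)
    h (fun _ => zero_mem D) (fun y z hy hz ihy ihz hyz => ?_) (fun a y _ ih hay => ?_) hy.1 hy
  · exact add_mem (ihy (hface.mem_of_add_mem_left hy hz hyz))
      (ihz (hface.mem_of_add_mem_right hy hz hyz))
  · rcases a.2.eq_or_lt with ha | ha
    · have ha0 : a = 0 := Subtype.ext ha.symm
      simp [ha0]
    · exact PointedCone.smul_mem D a.2 (ih ((PointedCone.smul_mem_iff _ ha).mp hay))

theorem exists_dual_pos_of_notMem_minFace {C : PointedCone 𝕜 V} (hC : C.FG) {x y : V}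
    (hx : x ∈ C) (hy : y ∈ C) (hxy : y ∉ minFace C x) :
    ∃ c : Module.Dual 𝕜 V, (∀ z ∈ C, 0 ≤ c z) ∧ c x = 0 ∧ 0 < c y := by
  obtain ⟨s, hs, rfl⟩ := Submodule.fg_def.mp hC
  have hn : -y ∉ PointedCone.hull 𝕜 (id '' insert (-x) s) := by
    rw [Set.image_id, Submodule.mem_span_insert]
    rintro ⟨a, z, hz, hyz⟩
    refine hxy ⟨hy, a, a.2, ?_⟩
    have hxyz : (a : 𝕜) • x - y = z := by
      rw [sub_eq_add_neg, hyz, Nonneg.coe_smul, smul_neg, add_neg_cancel_left]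
    exact hxyz ▸ hz
  obtain ⟨c, hc, hcy⟩ : ∃ c : Module.Dual 𝕜 V, (∀ z ∈ insert (-x) s, 0 ≤ c z) ∧ c (-y) < 0 := by
    simpa only [not_forall, not_le, exists_prop, id] using mt (farkas (hs.insert (-x)) id) hn
  have hcs : ∀ z ∈ PointedCone.hull 𝕜 s, 0 ≤ c z := fun z =>
    nonneg_of_mem_hull fun z hz => hc z (Set.mem_insert_of_mem _ hz)
  have hcx : c x ≤ 0 := by simpa using hc _ (Set.mem_insert (-x) s)
  exact ⟨c, hcs, hcx.antisymm (hcs x hx), by simpa using hcy⟩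

theorem exists_dual_eq_zero_iff_mem_minFace {C : PointedCone 𝕜 V} (hC : C.FG) {x : V}
    (hx : x ∈ C) :
    ∃ c : Module.Dual 𝕜 V, (∀ y ∈ C, 0 ≤ c y) ∧ ∀ y ∈ C, c y = 0 ↔ y ∈ minFace C x := by
  classical
  obtain ⟨s, hs⟩ := id hC
  have hsC : ∀ y ∈ s, y ∈ C := fun y hy => hs ▸ PointedCone.subset_hull hy
  have hsep : ∀ y ∈ s, ∃ c : Module.Dual 𝕜 V, (∀ z ∈ C, 0 ≤ c z) ∧
      c x = 0 ∧ (c y = 0 → y ∈ minFace C x) := by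
    intro y hy
    by_cases hyx : y ∈ minFace C x
    · exact ⟨0, by simp, rfl, fun _ => hyx⟩
    · obtain ⟨c, hc, hcx, hcy⟩ := exists_dual_pos_of_notMem_minFace hC hx (hsC y hy) hyx
      exact ⟨c, hc, hcx, fun h => absurd h hcy.ne'⟩
  choose! c hc hcx hcy using hsep
  have hsum (z : V) : (∑ y ∈ s, c y) z = ∑ y ∈ s, c y z := LinearMap.sum_apply ..
  have hnonneg : ∀ z ∈ C, 0 ≤ (∑ y ∈ s, c y) z := fun z hz =>
    hsum z ▸ Finset.sum_nonneg fun y hy => hc y hy z hz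
  refine ⟨∑ y ∈ s, c y, hnonneg, fun z hz => ⟨fun hz0 => ?_, ?_⟩⟩
  · have hz' : z ∈ PointedCone.hull 𝕜 (id '' (s : Set V)) := by
      rwa [Set.image_id, PointedCone.hull, hs]
    obtain ⟨d, hd, rfl⟩ := mem_hull_image_finset.mp hz'
    simp only [map_sum, map_smul, smul_eq_mul, id] at hz0 ⊢
    rw [Finset.sum_eq_zero_iff_of_nonneg
      fun y hy => mul_nonneg (hd y hy) (hnonneg y (hsC y hy))] at hz0
    refine sum_mem fun y hy => ?_
    rcases mul_eq_zero.mp (hz0 y hy) with h0 | h0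
    · simp [h0]
    · rw [hsum, Finset.sum_eq_zero_iff_of_nonneg fun k hk => hc k hk y (hsC y hy)] at h0
      exact PointedCone.smul_mem _ (hd y hy) (hcy y hy (h0 y hy))
  · rintro ⟨-, b, -, hbz⟩
    have hx0 : (∑ y ∈ s, c y) x = 0 := (hsum x).trans (Finset.sum_eq_zero hcx)
    have hle := hnonneg _ hbz
    rw [map_sub, map_smul, hx0, smul_zero, zero_sub, neg_nonneg] at hle
    exact hle.antisymm (hnonneg z hz)

end OrderedField

section ExtremeVectors

variable {n m t : ℕ}

theorem coe_hull_image {ι : Type*} (s : Finset ι) (v : ι → Fin m → ℚ) :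
    (PointedCone.hull ℚ (v '' s) : Set (Fin m → ℚ)) = posCone s v :=
  Set.ext fun _ => mem_hull_image_finset

theorem IsFace.isFaceOf {C F : PointedCone ℚ (Fin m → ℚ)}
    (h : IsFace (C : Set (Fin m → ℚ)) (F : Set (Fin m → ℚ))) : F.IsFaceOf C := by
  obtain ⟨c, hc, hF⟩ := h
  have mem_iff (x : Fin m → ℚ) : x ∈ F ↔ x ∈ C ∧ c ⬝ᵥ x = 0 := by
    rw [← SetLike.mem_coe, hF, Set.mem_sep_iff, SetLike.mem_coe]
  refine ⟨fun x hx => ((mem_iff x).mp hx).1, fun {x y a} hx hy ha hxy => ?_⟩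
  have h0 := ((mem_iff _).mp hxy).2
  rw [dotProduct_add, dotProduct_smul, smul_eq_mul,
    add_eq_zero_iff_of_nonneg (mul_nonneg ha.le (hc x hx)) (hc y hy)] at h0
  exact (mem_iff x).mpr ⟨hx, (mul_eq_zero.mp h0.1).resolve_left ha.ne'⟩

theorem isFace_minFace {C : PointedCone ℚ (Fin m → ℚ)} (hC : C.FG) {x : Fin m → ℚ} (hx : x ∈ C) :
    IsFace (C : Set (Fin m → ℚ)) (minFace C x : Set (Fin m → ℚ)) := by
  obtain ⟨c, hc, hcx⟩ := exists_dual_eq_zero_iff_mem_minFace hC hx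
  obtain ⟨c, rfl⟩ := (dotProductEquiv ℚ (Fin m)).surjective c
  exact ⟨c, hc, Set.ext fun y => ⟨fun hy => ⟨hy.1, (hcx y hy.1).mpr hy⟩,
    fun hy => (hcx y hy.1).mp hy.2⟩⟩

/-- The cone `σ = pos_ℚ(a₁, …, aₙ)` as a pointed cone; its underlying set is `sigma A`. -/
def sigmaCone (A : Fin n → Fin m → ℤ) : PointedCone ℚ (Fin m → ℚ) :=
  PointedCone.hull ℚ (Set.range fun i => toRat (A i))

/-- The cone `σ(S) = pos_ℚ(rⱼ : j ∈ S)` as a pointed cone; its underlying set is `subcone r S`. -/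
def rayCone (r : Fin t → Fin m → ℤ) (S : Finset (Fin t)) : PointedCone ℚ (Fin m → ℚ) :=
  PointedCone.hull ℚ ((fun j => toRat (r j)) '' S)

theorem coe_sigmaCone (A : Fin n → Fin m → ℤ) : (sigmaCone A : Set (Fin m → ℚ)) = sigma A := by
  rw [sigma, ← coe_hull_image, Finset.coe_univ, Set.image_univ, sigmaCone]

theorem coe_rayCone (r : Fin t → Fin m → ℤ) (S : Finset (Fin t)) :
    (rayCone r S : Set (Fin m → ℚ)) = subcone r S :=
  coe_hull_image ..

theorem sigmaCone_fg (A : Fin n → Fin m → ℤ) : (sigmaCone A).FG :=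
  Submodule.fg_span (Set.finite_range _)

theorem generator_mem_sigmaCone (A : Fin n → Fin m → ℤ) (i : Fin n) : toRat (A i) ∈ sigmaCone A :=
  PointedCone.subset_hull ⟨i, rfl⟩

theorem mem_sigmaCone {A : Fin n → Fin m → ℤ} {x : Fin m → ℚ} :
    x ∈ sigmaCone A ↔ ∃ d : Fin n → ℚ, (∀ i, 0 ≤ d i) ∧ x = ∑ i, d i • toRat (A i) := by
  rw [← SetLike.mem_coe, coe_sigmaCone]
  simp only [sigma, posCone, Finset.mem_univ, forall_const, Set.mem_ofPred_eq]

variable {A : Fin n → Fin m → ℤ} {r : Fin t → Fin m → ℤ}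

theorem mem_rayCone {S : Finset (Fin t)} {x : Fin m → ℚ} :
    x ∈ rayCone r S ↔ ∃ d : Fin t → ℚ, (∀ j ∈ S, 0 ≤ d j) ∧ x = ∑ j ∈ S, d j • toRat (r j) :=
  mem_hull_image_finset

theorem mem_rayCone_singleton {j : Fin t} {x : Fin m → ℚ} :
    x ∈ rayCone r {j} ↔ ∃ a : ℚ, 0 ≤ a ∧ x = a • toRat (r j) := by
  simp only [mem_rayCone, Finset.mem_singleton, forall_eq, Finset.sum_singleton]
  exact ⟨fun ⟨d, hd, hx⟩ => ⟨d j, hd, hx⟩, fun ⟨a, ha, hx⟩ => ⟨fun _ => a, ha, hx⟩⟩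

theorem ray_mem_rayCone {S : Finset (Fin t)} {j : Fin t} (hj : j ∈ S) : toRat (r j) ∈ rayCone r S :=
  PointedCone.subset_hull (Set.mem_image_of_mem _ hj)

theorem rayCone_mono {S T : Finset (Fin t)} (h : S ⊆ T) : rayCone r S ≤ rayCone r T :=
  Submodule.span_mono (Set.image_mono h)

namespace IsExtremeVectors

theorem isFaceOf_singleton (hr : IsExtremeVectors A r) (j : Fin t) :
    (rayCone r {j}).IsFaceOf (sigmaCone A) := by
  refine IsFace.isFaceOf ?_
  rw [coe_rayCone, coe_sigmaCone]
  exact (hr.1 j).1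

theorem mem_sigmaCone (hr : IsExtremeVectors A r) (j : Fin t) : toRat (r j) ∈ sigmaCone A :=
  (hr.isFaceOf_singleton j).le (ray_mem_rayCone (Finset.mem_singleton_self j))

theorem ne_zero (hr : IsExtremeVectors A r) (j : Fin t) : toRat (r j) ≠ 0 := by
  intro h0
  have hspan : Submodule.span ℚ (posCone {j} fun k => toRat (r k)) = ⊥ := by
    rw [Submodule.span_eq_bot]
    rintro _ ⟨d, -, rfl⟩
    simp [h0]
  have hdim := (hr.1 j).2
  rw [hspan, finrank_bot] at hdim
  exact zero_ne_one hdim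

theorem eq_of_mem_singleton (hr : IsExtremeVectors A r) {j k : Fin t}
    (h : toRat (r j) ∈ rayCone r {k}) : j = k := by
  obtain ⟨a, ha, haj⟩ := mem_rayCone_singleton.mp h
  have ha0 : a ≠ 0 := by
    rintro rfl
    exact hr.ne_zero j (by rw [haj, zero_smul])
  have hray : rayCone r {k} = rayCone r {j} := by
    ext x
    rw [mem_rayCone_singleton, mem_rayCone_singleton]
    constructor
    · rintro ⟨b, hb, rfl⟩
      exact ⟨b * a⁻¹, by positivity, by rw [haj, smul_smul, inv_mul_cancel_right₀ ha0]⟩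
    · rintro ⟨b, hb, rfl⟩
      exact ⟨b * a, by positivity, by rw [haj, smul_smul]⟩
  have hset : subcone r {k} = subcone r {j} := by rw [← coe_rayCone, hray, coe_rayCone]
  exact (hr.2 _ (hr.1 k)).unique hset rfl

theorem mem_of_mem_rayCone (hr : IsExtremeVectors A r) {k : Fin t} {S : Finset (Fin t)}
    (h : toRat (r k) ∈ rayCone r S) : k ∈ S := by
  obtain ⟨d, hd, hk⟩ := mem_rayCone.mp h
  obtain ⟨j, hj, hdj⟩ : ∃ j ∈ S, 0 < d j := by
    by_contra! hd0
    refine hr.ne_zero k (hk.trans (Finset.sum_eq_zero fun j hj => ?_))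
    rw [le_antisymm (hd0 j hj) (hd j hj), zero_smul]
  have hjk : toRat (r j) ∈ rayCone r {k} :=
    mem_face_of_sum_smul_mem (hr.isFaceOf_singleton k) (v := fun j => toRat (r j))
      (fun j _ => hr.mem_sigmaCone j) hd (hk ▸ ray_mem_rayCone (Finset.mem_singleton_self k)) hj hdj
  rwa [← hr.eq_of_mem_singleton hjk]

theorem exists_generator (hr : IsExtremeVectors A r) (j : Fin t) :
    ∃ i, ∃ a : ℚ, 0 < a ∧ toRat (A i) = a • toRat (r j) := by
  obtain ⟨d, hd, hj⟩ := LatticeIdeal.mem_sigmaCone.mp (hr.mem_sigmaCone j)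
  obtain ⟨i, -, hi⟩ : ∃ i ∈ Finset.univ, d i • toRat (A i) ≠ 0 :=
    Finset.exists_ne_zero_of_sum_ne_zero (hj ▸ hr.ne_zero j)
  obtain ⟨hdi, hAi⟩ := smul_ne_zero_iff.mp hi
  have hij : toRat (A i) ∈ rayCone r {j} :=
    mem_face_of_sum_smul_mem (hr.isFaceOf_singleton j) (fun i _ => generator_mem_sigmaCone A i)
      (fun i _ => hd i) (hj ▸ ray_mem_rayCone (Finset.mem_singleton_self j)) (Finset.mem_univ i)
      ((hd i).lt_of_ne' hdi)
  obtain ⟨a, ha, hai⟩ := mem_rayCone_singleton.mp hij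
  refine ⟨i, a, ha.lt_of_ne' ?_, hai⟩
  rintro rfl
  exact hAi (by rw [hai, zero_smul])

end IsExtremeVectors

namespace IsMinimalNonFace

variable {E : Finset (Fin t)}

theorem isFaceOf_of_ssubset (hE : IsMinimalNonFace A r E) (hr : IsExtremeVectors A r)
    {S : Finset (Fin t)} (hS : S ⊂ E) : (rayCone r S).IsFaceOf (sigmaCone A) := by
  by_contra hface
  have hface' : ¬ IsFace (sigma A) (subcone r S) := by
    rw [← coe_sigmaCone, ← coe_rayCone]
    exact mt IsFace.isFaceOf hface
  have hle : subcone r S ⊆ subcone r E := by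
    rw [← coe_rayCone, ← coe_rayCone]
    exact rayCone_mono hS.subset
  have heq := hE.2 S hface' hle
  rw [← coe_rayCone, ← coe_rayCone, SetLike.coe_set_eq] at heq
  exact hS.2 fun j hj => hr.mem_of_mem_rayCone (heq ▸ ray_mem_rayCone hj)

theorem singleton_ssubset (hE : IsMinimalNonFace A r E) (hr : IsExtremeVectors A r) {j : Fin t}
    (hj : j ∈ E) : {j} ⊂ E := by
  refine (Finset.singleton_subset_iff.mpr hj).ssubset_of_ne ?_
  rintro rfl
  exact hE.1 (hr.1 j).1

theorem pos_iff_notMem_rayCone_erase (hE : IsMinimalNonFace A r E) (hr : IsExtremeVectors A r)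
    {d : Fin t → ℚ} (hd : ∀ k ∈ E, 0 ≤ d k) {j : Fin t} (hj : j ∈ E) :
    0 < d j ↔ ∑ k ∈ E, d k • toRat (r k) ∉ rayCone r (E.erase j) := by
  constructor
  · intro hdj hx
    have hface := hE.isFaceOf_of_ssubset hr (Finset.erase_ssubset hj)
    exact Finset.notMem_erase j E (hr.mem_of_mem_rayCone (mem_face_of_sum_smul_mem hface
      (v := fun k => toRat (r k)) (fun k _ => hr.mem_sigmaCone k) hd hx hj hdj))
  · intro hx
    refine (hd j hj).lt_of_ne fun hdj => hx ?_
    rw [← Finset.add_sum_erase E _ hj, ← hdj, zero_smul, zero_add]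
    exact mem_rayCone.mpr ⟨d, fun k hk => hd k (Finset.mem_of_mem_erase hk), rfl⟩

theorem mem_relintCone_iff (hE : IsMinimalNonFace A r E) (hr : IsExtremeVectors A r)
    {x : Fin m → ℚ} (hx : x ∈ rayCone r E) :
    x ∈ relintCone E (fun j => toRat (r j)) ↔ ∀ j ∈ E, x ∉ rayCone r (E.erase j) := by
  constructor
  · rintro ⟨d, hd, rfl⟩ j hj
    exact (hE.pos_iff_notMem_rayCone_erase hr (fun k hk => (hd k hk).le) hj).mp (hd j hj)
  · intro h
    obtain ⟨d, hd, rfl⟩ := mem_rayCone.mp hx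
    exact ⟨d, fun j hj => (hE.pos_iff_notMem_rayCone_erase hr hd hj).mpr (h j hj), rfl⟩

theorem mem_rayCone_sdiff_iff (hE : IsMinimalNonFace A r E) (hr : IsExtremeVectors A r)
    {T : Finset (Fin t)} (hTE : T ⊆ E) (hT : T.Nonempty) {x : Fin m → ℚ} :
    x ∈ rayCone r (E \ T) ↔ ∀ j ∈ T, x ∈ rayCone r (E.erase j) := by
  constructor
  · exact fun hx j hj => rayCone_mono (fun k hk => Finset.mem_erase.mpr
      ⟨fun hkj => (Finset.mem_sdiff.mp hk).2 (hkj ▸ hj), (Finset.mem_sdiff.mp hk).1⟩) hx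
  · intro hx
    obtain ⟨j, hj⟩ := hT
    obtain ⟨d, hd, rfl⟩ := mem_rayCone.mp (rayCone_mono (Finset.erase_subset j E) (hx j hj))
    have hdT : ∀ k ∈ T, d k = 0 := fun k hk => le_antisymm
      (not_lt.mp ((hE.pos_iff_notMem_rayCone_erase hr hd (hTE hk)).not_left.mpr (hx k hk)))
      (hd k (hTE hk))
    rw [← Finset.sum_sdiff hTE, Finset.sum_eq_zero (s := T) fun k hk => by rw [hdT k hk, zero_smul],
      add_zero]
    exact mem_rayCone.mpr ⟨d, fun k hk => hd k (Finset.sdiff_subset hk), rfl⟩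

end IsMinimalNonFace

end ExtremeVectors

section IndicatorPoint

variable {R σ κ : Type*} [CommRing R]

open Classical in
theorem eval_indicator_one_monomial (V : Set σ) (w : σ →₀ ℕ) (a : R) :
    eval (V.indicator 1) (monomial w a) = if (w.support : Set σ) ⊆ V then a else 0 := by
  rw [eval_monomial, Finsupp.prod]
  split_ifs with hw
  · rw [Finset.prod_eq_one, mul_one]
    intro i hi
    rw [Set.indicator_of_mem (hw hi), Pi.one_apply, one_pow]
  · obtain ⟨i, hi, hiV⟩ := Set.not_subset.mp hw
    rw [Finset.prod_eq_zero hi, mul_zero]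
    rw [Set.indicator_of_notMem hiV, zero_pow (Finsupp.mem_support_iff.mp hi)]

open Classical in
theorem eval_indicator_one (V : Set σ) (F : MvPolynomial σ R) :
    eval (V.indicator 1) F = ∑ w ∈ F.support with (w.support : Set σ) ⊆ V, coeff w F := by
  conv_lhs => rw [F.as_sum, map_sum]
  simp only [eval_indicator_one_monomial, Finset.sum_filter]

theorem exists_mem_support_of_eval_iUnion_ne_zero {E : Finset κ} {V : κ → Set σ}
    {F : MvPolynomial σ R}
    (hinter : ∀ T ⊆ E, T.Nonempty → eval ((⋂ j ∈ T, V j).indicator 1) F = 0)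
    (hunion : eval ((⋃ j ∈ E, V j).indicator 1) F ≠ 0) :
    ∃ w ∈ F.support, (w.support : Set σ) ⊆ ⋃ j ∈ E, V j ∧ ∀ j ∈ E, ¬ (w.support : Set σ) ⊆ V j := by
  classical
  by_contra! hF
  refine hunion ?_
  let S (j : κ) : Finset (σ →₀ ℕ) := {w ∈ F.support | (w.support : Set σ) ⊆ V j}
  have hS : {w ∈ F.support | (w.support : Set σ) ⊆ ⋃ j ∈ E, V j} = E.biUnion S := by
    ext w
    simp only [S, Finset.mem_filter, Finset.mem_biUnion]
    refine ⟨fun hw => ?_, fun ⟨j, hj, hw⟩ =>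
      ⟨hw.1, hw.2.trans (Set.subset_biUnion_of_mem (u := V) (Finset.mem_coe.mpr hj))⟩⟩
    obtain ⟨j, hj, hwj⟩ := hF w hw.1 hw.2
    exact ⟨j, hj, hw.1, hwj⟩
  rw [eval_indicator_one, hS, Finset.inclusion_exclusion_sum_biUnion]
  refine Finset.sum_eq_zero fun T _ => ?_
  obtain ⟨hTE, hT⟩ := Finset.mem_filter.mp T.2
  have hST : T.1.inf' hT S = {w ∈ F.support | (w.support : Set σ) ⊆ ⋂ j ∈ T.1, V j} := by
    ext w
    simp only [S, Finset.mem_inf', Finset.mem_filter, Set.subset_iInter_iff]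
    exact ⟨fun h => ⟨(h _ hT.choose_spec).1, fun j hj => (h j hj).2⟩,
      fun h j hj => ⟨h.1, h.2 j hj⟩⟩
  rw [hST, ← eval_indicator_one, hinter T.1 (Finset.mem_powerset.mp hTE) hT, smul_zero]

theorem le_ker_eval_iff_of_radical_eq [IsDomain R] {I J : Ideal (MvPolynomial σ R)}
    (h : I.radical = J.radical) (p : σ → R) :
    I ≤ RingHom.ker (eval p) ↔ J ≤ RingHom.ker (eval p) := by
  have hprime := RingHom.ker_isPrime (eval p)
  rw [← hprime.radical_le_iff, h, hprime.radical_le_iff]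

end IndicatorPoint

section Grading

variable {n : ℕ} {M N : Type*} [AddCommGroup M] [AddCommGroup N]

theorem weight_eq_degMap (f : Fin n → M) (w : Fin n →₀ ℕ) :
    Finsupp.weight f w = degMap f fun i => (w i : ℤ) := by
  simp only [Finsupp.weight_apply, Finsupp.sum_fintype, zero_smul, implies_true, degMap,
    Fintype.linearCombination_apply, natCast_zsmul]

theorem weight_eq_weight_iff (f : Fin n → M) (w w' : Fin n →₀ ℕ) :
    Finsupp.weight f w = Finsupp.weight f w' ↔
      (fun i => (w i - w' i : ℤ)) ∈ relationLattice f := by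
  rw [weight_eq_degMap, weight_eq_degMap, ← sub_eq_zero, ← map_sub]
  rfl

theorem weight_eq_of_relationLattice_le {f : Fin n → M} {g : Fin n → N}
    (hgf : relationLattice g ≤ relationLattice f) {w w' : Fin n →₀ ℕ}
    (h : Finsupp.weight g w = Finsupp.weight g w') : Finsupp.weight f w = Finsupp.weight f w' :=
  (weight_eq_weight_iff f w w').mpr (hgf ((weight_eq_weight_iff g w w').mp h))

theorem mem_support_posPart {α : Fin n → ℤ} {i : Fin n} : i ∈ (posPart α).support ↔ 0 < α i := by
  rw [Finsupp.mem_support_iff, posPart, Finsupp.equivFunOnFinite_symm_apply_apply]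
  lia

theorem weight_posPart_eq_iff (f : Fin n → M) (α : Fin n → ℤ) :
    Finsupp.weight f (posPart α) = Finsupp.weight f (posPart (-α)) ↔ α ∈ relationLattice f := by
  rw [weight_eq_weight_iff]
  simp only [posPart, Finsupp.equivFunOnFinite_symm_apply_apply, Pi.neg_apply,
    Int.toNat_sub_toNat_neg]

theorem weight_toRat {m : ℕ} (A : Fin n → Fin m → ℤ) (w : Fin n →₀ ℕ) :
    Finsupp.weight (fun i => toRat (A i)) w = toRat (Finsupp.weight A w) := by
  rw [weight_eq_degMap A, ← toRat_sum, Finsupp.weight_apply,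
    Finsupp.sum_fintype _ _ (by simp)]
  simp only [Int.cast_natCast, Nat.cast_smul_eq_nsmul]

theorem saturation_mono {L L' : Submodule ℤ (Fin n → ℤ)} (h : L ≤ L') :
    saturation L ⊆ saturation L' :=
  fun _ ⟨d, hd, hdα⟩ => ⟨d, hd, h hdα⟩

theorem subset_saturation (L : Submodule ℤ (Fin n → ℤ)) : (L : Set (Fin n → ℤ)) ⊆ saturation L :=
  fun α hα => ⟨1, one_ne_zero, by rwa [one_smul]⟩

variable {K : Type*} [Field K]

theorem IsHomogeneousIdeal.component_mem {f : Fin n → M} {J : Ideal (MvPolynomial (Fin n) K)}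
    (hJ : IsHomogeneousIdeal f J) {F : MvPolynomial (Fin n) K} (hF : F ∈ J) (d : M) :
    weightedHomogeneousComponent f d F ∈ J := by
  classical
  let _ := weightedGradedAlgebra K f
  obtain ⟨S, hS, rfl⟩ := hJ
  exact weightedHomogeneousComponent_mem_of_mem K f (Ideal.homogeneous_span _ S hS) hF d

theorem IsSpecialization.relationLattice_le {f : Fin n → M} {g : Fin n → N}
    (h : IsSpecialization K f g) : relationLattice g ≤ relationLattice f := by
  classical
  intro α hα
  rw [← weight_posPart_eq_iff] at hα ⊢
  set w := posPart α
  set w' := posPart (-α)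
  set F : MvPolynomial (Fin n) K := monomial w 1 - monomial w' 1
  have hF : IsHomogeneousPoly g F := ⟨Finsupp.weight g w,
    (weightedHomogeneousSubmodule K g _).sub_mem (isWeightedHomogeneous_monomial g _ _ rfl)
      (isWeightedHomogeneous_monomial g _ _ hα.symm)⟩
  have hhom : IsHomogeneousIdeal f (Ideal.span {F}) := h _ ⟨{F}, by simpa using hF, rfl⟩
  by_contra hne
  have hcomp : weightedHomogeneousComponent f (Finsupp.weight f w) F = monomial w 1 := by
    rw [map_sub, weightedHomogeneousComponent_of_mem (isWeightedHomogeneous_monomial f _ _ rfl),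
      weightedHomogeneousComponent_of_mem (isWeightedHomogeneous_monomial f _ _ rfl),
      if_pos rfl, if_neg hne, sub_zero]
  have hmem : monomial w 1 ∈ Ideal.span {F} :=
    hcomp ▸ hhom.component_mem (Ideal.mem_span_singleton_self F) (Finsupp.weight f w)
  have hker : Ideal.span {F} ≤ RingHom.ker (eval fun _ => (1 : K)) := by
    simp [F, eval_monomial, Ideal.span_le]
  simpa [eval_monomial] using hker hmem

theorem component_weight_ne_zero (f : Fin n → M) {F : MvPolynomial (Fin n) K} {w : Fin n →₀ ℕ}
    (hw : w ∈ F.support) : weightedHomogeneousComponent f (Finsupp.weight f w) F ≠ 0 := by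
  classical
  intro h0
  have h := congrArg (coeff w) h0
  rw [coeff_weightedHomogeneousComponent, if_pos rfl, coeff_zero] at h
  exact mem_support_iff.mp hw h

end Grading

section InteriorMonomials

variable {n m t : ℕ} {A : Fin n → Fin m → ℤ} {r : Fin t → Fin m → ℤ}

/-- The variables `xᵢ` whose degree `aᵢ` lies in the cone `σ(S)`. -/
def faceVars (A : Fin n → Fin m → ℤ) (r : Fin t → Fin m → ℤ) (S : Finset (Fin t)) : Set (Fin n) :=
  {i | toRat (A i) ∈ rayCone r S}

/-- The variables whose degree lies on the boundary of `σ(E)`; if `σ(E)` is a minimal non-face, its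
proper faces `σ(E \ {j})` are faces of `σ`. -/
def boundaryVars (A : Fin n → Fin m → ℤ) (r : Fin t → Fin m → ℤ) (E : Finset (Fin t)) :
    Set (Fin n) :=
  ⋃ j ∈ E, faceVars A r (E.erase j)

/-- The monomial `x^w` involves only variables on the boundary of `σ(E)`, but its degree is in the
relative interior of `σ(E)`. -/
def IsInteriorMonomial (A : Fin n → Fin m → ℤ) (r : Fin t → Fin m → ℤ) (E : Finset (Fin t))
    (w : Fin n →₀ ℕ) : Prop :=
  (w.support : Set (Fin n)) ⊆ boundaryVars A r E ∧
    Finsupp.weight (fun i => toRat (A i)) w ∈ relintCone E fun j => toRat (r j)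

theorem weight_mem_rayCone_iff {S : Finset (Fin t)} (hS : (rayCone r S).IsFaceOf (sigmaCone A))
    (w : Fin n →₀ ℕ) :
    Finsupp.weight (fun i => toRat (A i)) w ∈ rayCone r S ↔
      (w.support : Set (Fin n)) ⊆ faceVars A r S :=
  weight_mem_face_iff hS (generator_mem_sigmaCone A) w

theorem boundaryVars_subset (A : Fin n → Fin m → ℤ) (r : Fin t → Fin m → ℤ) (E : Finset (Fin t)) :
    boundaryVars A r E ⊆ faceVars A r E :=
  Set.iUnion₂_subset fun j _ _ hi => rayCone_mono (Finset.erase_subset j E) hi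

theorem weight_mem_rayCone_of_subset_boundaryVars {E : Finset (Fin t)} {w : Fin n →₀ ℕ}
    (hw : (w.support : Set (Fin n)) ⊆ boundaryVars A r E) :
    Finsupp.weight (fun i => toRat (A i)) w ∈ rayCone r E := by
  rw [Finsupp.weight_apply]
  exact sum_mem fun i hi => nsmul_mem (boundaryVars_subset A r E (hw hi)) _

variable {E : Finset (Fin t)}

theorem isInteriorMonomial_iff (hE : IsMinimalNonFace A r E) (hr : IsExtremeVectors A r)
    {w : Fin n →₀ ℕ} :
    IsInteriorMonomial A r E w ↔ (w.support : Set (Fin n)) ⊆ boundaryVars A r E ∧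
      ∀ j ∈ E, ¬ (w.support : Set (Fin n)) ⊆ faceVars A r (E.erase j) := by
  refine and_congr_right fun hw => ?_
  rw [hE.mem_relintCone_iff hr (weight_mem_rayCone_of_subset_boundaryVars hw)]
  exact forall₂_congr fun j hj =>
    (weight_mem_rayCone_iff (hE.isFaceOf_of_ssubset hr (Finset.erase_ssubset hj)) w).not

namespace IsInteriorMonomial

theorem mem_iff_exists_mem_minFace {w : Fin n →₀ ℕ} (hw : IsInteriorMonomial A r E w)
    (hE : IsMinimalNonFace A r E) (hr : IsExtremeVectors A r) (j : Fin t) :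
    j ∈ E ↔ ∃ i ∈ w.support, toRat (r j) ∈ minFace (sigmaCone A) (toRat (A i)) := by
  obtain ⟨hbdry, hnot⟩ := (isInteriorMonomial_iff hE hr).mp hw
  constructor
  · intro hj
    obtain ⟨i, hi, hij⟩ := Set.not_subset.mp (hnot j hj)
    obtain ⟨d, hd, hAi⟩ := mem_rayCone.mp (boundaryVars_subset A r E (hbdry hi))
    have hdj : 0 < d j := (hE.pos_iff_notMem_rayCone_erase hr hd hj).mpr (hAi ▸ hij)
    exact ⟨i, hi, mem_face_of_sum_smul_mem (isFaceOf_minFace _ _) (v := fun j => toRat (r j))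
      (fun k _ => hr.mem_sigmaCone k) hd (hAi ▸ self_mem_minFace (generator_mem_sigmaCone A i))
      hj hdj⟩
  · rintro ⟨i, hi, hj⟩
    obtain ⟨k, hk, hik⟩ := Set.mem_iUnion₂.mp (hbdry hi)
    have hface := hE.isFaceOf_of_ssubset hr (Finset.erase_ssubset hk)
    exact Finset.mem_of_mem_erase (hr.mem_of_mem_rayCone (minFace_le_of_isFaceOf hface hik hj))

theorem unique {E' : Finset (Fin t)} {w : Fin n →₀ ℕ} (hw : IsInteriorMonomial A r E w)
    (hw' : IsInteriorMonomial A r E' w) (hE : IsMinimalNonFace A r E)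
    (hE' : IsMinimalNonFace A r E') (hr : IsExtremeVectors A r) : E = E' :=
  Finset.ext fun j => (hw.mem_iff_exists_mem_minFace hE hr j).trans
    (hw'.mem_iff_exists_mem_minFace hE' hr j).symm

theorem weight_mem_relintCone_coneProjection {q : ℕ} {B : Fin n → Fin q → ℤ} {w : Fin n →₀ ℕ}
    (hw : IsInteriorMonomial A r E w) (hAB : relationLattice A ≤ relationLattice B) :
    Finsupp.weight (fun i => toRat (B i)) w ∈
      relintCone E fun j => coneProjection A B (toRat (r j)) := by
  obtain ⟨d, hd, hsum⟩ := hw.2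
  refine ⟨d, hd, ?_⟩
  have h := congrArg (coneProjection A B) hsum
  simpa only [Finsupp.weight_apply, Finsupp.sum, map_sum, map_nsmul, map_smul,
    coneProjection_apply A B hAB] using h

end IsInteriorMonomial

variable {K : Type*} [Field K] {G : Type*} [AddCommGroup G] {g : Fin n → G}

theorem latticeIdeal_le_ker_eval_faceVars (hgA : relationLattice g ≤ relationLattice A)
    {S : Finset (Fin t)} (hS : (rayCone r S).IsFaceOf (sigmaCone A)) :
    latticeIdeal K (relationLattice g) ≤ RingHom.ker (eval ((faceVars A r S).indicator 1)) := by
  classical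
  refine Ideal.span_le.mpr ?_
  rintro _ ⟨α, hα, rfl⟩
  have hweight := congrArg toRat ((weight_posPart_eq_iff A α).mpr (hgA hα))
  have hsupp : ((posPart α).support : Set (Fin n)) ⊆ faceVars A r S ↔
      ((posPart (-α)).support : Set (Fin n)) ⊆ faceVars A r S := by
    rw [← weight_mem_rayCone_iff hS, ← weight_mem_rayCone_iff hS, weight_toRat, weight_toRat,
      hweight]
  rw [SetLike.mem_coe, RingHom.mem_ker, map_sub, eval_indicator_one_monomial,
    eval_indicator_one_monomial, if_congr hsupp rfl rfl, sub_self]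

theorem IsMinimalNonFace.iInter_faceVars (hE : IsMinimalNonFace A r E) (hr : IsExtremeVectors A r)
    {T : Finset (Fin t)} (hTE : T ⊆ E) (hT : T.Nonempty) :
    ⋂ j ∈ T, faceVars A r (E.erase j) = faceVars A r (E \ T) := by
  ext i
  rw [Set.mem_iInter₂]
  exact (hE.mem_rayCone_sdiff_iff hr hTE hT).symm

theorem exists_generator_mem_minFace_of_not_isFace (hE : ¬ IsFace (sigma A) (subcone r E))
    {x : Fin m → ℚ} (hx : x ∈ sigmaCone A)
    (hrx : ∀ j ∈ E, toRat (r j) ∈ minFace (sigmaCone A) x) :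
    ∃ i, toRat (A i) ∈ minFace (sigmaCone A) x ∧ toRat (A i) ∉ rayCone r E := by
  by_contra! hle
  have hface : minFace (sigmaCone A) x = rayCone r E :=
    (minFace_hull_le (Set.forall_mem_range.mpr hle)).antisymm
      (Submodule.span_le.mpr (Set.forall_mem_image.mpr hrx))
  refine hE ?_
  rw [← coe_sigmaCone, ← coe_rayCone, ← hface]
  exact isFace_minFace (sigmaCone_fg A) hx

open Classical in
theorem IsMinimalNonFace.ray_mem_minFace_sum_boundaryVars (hE : IsMinimalNonFace A r E)
    (hr : IsExtremeVectors A r) {j : Fin t} (hj : j ∈ E) :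
    toRat (r j) ∈ minFace (sigmaCone A) (∑ i with i ∈ boundaryVars A r E, toRat (A i)) := by
  obtain ⟨i, a, ha, hi⟩ := hr.exists_generator j
  obtain ⟨k, hk, hkj⟩ := Finset.exists_of_ssubset (hE.singleton_ssubset hr hj)
  have hjk : {j} ⊆ E.erase k := Finset.singleton_subset_iff.mpr
    (Finset.mem_erase.mpr ⟨fun hjk => hkj (Finset.mem_singleton.mpr hjk.symm), hj⟩)
  have hij : i ∈ boundaryVars A r E := Set.mem_biUnion (Finset.mem_coe.mpr hk)
    (rayCone_mono hjk (mem_rayCone_singleton.mpr ⟨a, ha.le, hi⟩))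
  have hmem : toRat (A i) ∈ minFace (sigmaCone A) (∑ i with i ∈ boundaryVars A r E, toRat (A i)) :=
    mem_minFace_sum (fun k _ => generator_mem_sigmaCone A k)
      (Finset.mem_filter.mpr ⟨Finset.mem_univ i, hij⟩)
  exact (PointedCone.smul_mem_iff _ ha).mp (hi ▸ hmem)

theorem exists_mem_relationLattice_of_sum_eq_zero
    (hA : saturation (relationLattice g) = (relationLattice A : Set (Fin n → ℤ)))
    {e : Fin n → ℚ} (he : ∑ i, e i • toRat (A i) = 0) :
    ∃ β ∈ relationLattice g, ∃ c : ℚ, 0 < c ∧ ∀ i, (β i : ℚ) = c * e i := by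
  obtain ⟨⟨N, hN⟩, hNe⟩ := IsLocalization.exist_integer_multiples_of_finite (nonZeroDivisors ℤ) e
  have hz : ∀ i, ∃ z : ℤ, (z : ℚ) = N * e i := fun i => by
    simpa [IsLocalization.IsInteger] using hNe i
  choose z hz using hz
  have hzA : toRat (degMap A z) = toRat 0 := by
    rw [← toRat_sum]
    simp only [hz, mul_smul, ← Finset.smul_sum, he, smul_zero]
    ext k
    simp [toRat]
  have hzA' : z ∈ relationLattice A := funext fun k => Int.cast_injective (congrFun hzA k)
  obtain ⟨d, hd, hdz⟩ : z ∈ saturation (relationLattice g) := hA ▸ hzA'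
  have hN0 : N ≠ 0 := nonZeroDivisors.ne_zero hN
  refine ⟨(d * N) • d • z, Submodule.smul_mem _ _ hdz, ((d * N : ℤ) : ℚ) ^ 2, ?_, fun i => ?_⟩
  · have : ((d * N : ℤ) : ℚ) ≠ 0 := by exact_mod_cast mul_ne_zero hd hN0
    positivity
  · simp only [Pi.smul_apply, smul_eq_mul, Int.cast_mul, hz]
    ring

theorem IsMinimalNonFace.exists_relation (hE : IsMinimalNonFace A r E) (hr : IsExtremeVectors A r)
    (hA : saturation (relationLattice g) = (relationLattice A : Set (Fin n → ℤ))) :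
    ∃ β ∈ relationLattice g, (∀ k, 0 < β k → k ∈ boundaryVars A r E) ∧
      ∃ i, β i < 0 ∧ i ∉ boundaryVars A r E := by
  classical
  obtain ⟨i, ⟨-, b, -, hbx⟩, hi⟩ := exists_generator_mem_minFace_of_not_isFace hE.1
    (sum_mem fun k _ => generator_mem_sigmaCone A k)
    fun j => hE.ray_mem_minFace_sum_boundaryVars hr
  obtain ⟨d, hd, hsum⟩ := mem_sigmaCone.mp hbx
  let e (k : Fin n) : ℚ :=
    (if k ∈ boundaryVars A r E then b else 0) - (if k = i then 1 else 0) - d k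
  have he : ∑ k, e k • toRat (A k) = 0 := by
    simp only [e, sub_smul, ite_smul, zero_smul, one_smul, Finset.sum_sub_distrib,
      ← Finset.sum_filter, ← Finset.smul_sum, Finset.filter_eq', Finset.mem_univ, if_true,
      Finset.sum_singleton, hsum, sub_self]
  have hibdry : i ∉ boundaryVars A r E := fun h => hi (boundaryVars_subset A r E h)
  obtain ⟨β, hβ, c, hc, hβe⟩ := exists_mem_relationLattice_of_sum_eq_zero hA he
  refine ⟨β, hβ, fun k hk => ?_, i, ?_, hibdry⟩
  · by_contra hkbdry
    have hek : e k ≤ 0 := by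
      have h1 : (0 : ℚ) ≤ if k = i then 1 else 0 := by positivity
      simp only [e, if_neg hkbdry]
      linarith [hd k]
    have hβk : (β k : ℚ) ≤ 0 := hβe k ▸ mul_nonpos_of_nonneg_of_nonpos hc.le hek
    exact hk.not_ge (by exact_mod_cast hβk)
  · have hei : e i < 0 := by
      simp only [e, if_neg hibdry, if_true]
      linarith [hd i]
    have hβi : (β i : ℚ) < 0 := hβe i ▸ mul_neg_of_pos_of_neg hc hei
    exact_mod_cast hβi

theorem not_latticeIdeal_le_ker_eval_boundaryVars (hE : IsMinimalNonFace A r E)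
    (hr : IsExtremeVectors A r)
    (hA : saturation (relationLattice g) = (relationLattice A : Set (Fin n → ℤ))) :
    ¬ latticeIdeal K (relationLattice g) ≤
      RingHom.ker (eval ((boundaryVars A r E).indicator 1)) := by
  classical
  obtain ⟨β, hβ, hpos, i, hi, hibdry⟩ := hE.exists_relation hr hA
  intro hle
  have h0 := hle (Ideal.subset_span ⟨β, hβ, rfl⟩)
  have hplus : ((posPart β).support : Set (Fin n)) ⊆ boundaryVars A r E := fun k hk =>
    hpos k (mem_support_posPart.mp hk)
  have hminus : ¬ ((posPart (-β)).support : Set (Fin n)) ⊆ boundaryVars A r E := fun h =>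
    hibdry (h (mem_support_posPart.mpr (neg_pos.mpr hi)))
  rw [RingHom.mem_ker, map_sub, eval_indicator_one_monomial, eval_indicator_one_monomial,
    if_pos hplus, if_neg hminus, sub_zero] at h0
  exact one_ne_zero h0

theorem exists_isInteriorMonomial {κ : Type*}
    (hA : saturation (relationLattice g) = (relationLattice A : Set (Fin n → ℤ)))
    (hr : IsExtremeVectors A r) {P : κ → MvPolynomial (Fin n) K}
    (hP : (Ideal.span (Set.range P)).radical = (latticeIdeal K (relationLattice g)).radical)
    (hE : IsMinimalNonFace A r E) :
    ∃ i, ∃ w ∈ (P i).support, IsInteriorMonomial A r E w := by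
  have hgA : relationLattice g ≤ relationLattice A := fun _ hα => hA.subset (subset_saturation _ hα)
  obtain ⟨i, hi⟩ : ∃ i, eval ((boundaryVars A r E).indicator 1) (P i) ≠ 0 := by
    have hnot := not_latticeIdeal_le_ker_eval_boundaryVars (K := K) hE hr hA
    rw [← le_ker_eval_iff_of_radical_eq hP, Ideal.span_le] at hnot
    simpa [Set.range_subset_iff] using hnot
  have hproper : ∀ T ⊆ E, T.Nonempty →
      eval ((⋂ j ∈ T, faceVars A r (E.erase j)).indicator 1) (P i) = 0 := by
    intro T hTE hT
    have hface := hE.isFaceOf_of_ssubset hr (Finset.sdiff_ssubset hTE hT)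
    rw [hE.iInter_faceVars hr hTE hT]
    exact (le_ker_eval_iff_of_radical_eq hP _).mpr (latticeIdeal_le_ker_eval_faceVars hgA hface)
      (Ideal.subset_span ⟨i, rfl⟩)
  obtain ⟨w, hw, hint⟩ := exists_mem_support_of_eval_iUnion_ne_zero hproper hi
  exact ⟨i, w, hw, (isInteriorMonomial_iff hE hr).mpr hint⟩

end InteriorMonomials

section Matchings

variable {V β : Type*} [DecidableEq V] {D : PreAbstractSimplicialComplex V}

theorem IsMatching.mem_vertices_of_mem_biUnion {M : Finset (Finset V)} (hM : IsMatching D M)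
    {v : V} (hv : v ∈ M.biUnion id) : v ∈ vertices D := by
  obtain ⟨T, hT, hvT⟩ := Finset.mem_biUnion.mp hv
  exact (D.isRelLowerSet_faces (hM.1 T hT)).2 (Finset.singleton_subset_iff.mpr hvT)
    (Finset.singleton_nonempty v)

variable [Fintype V]

theorem delta_le_card_of_isMatching {M : Finset (Finset V)} (hM : IsMatching D M)
    (hcov : ∀ v ∈ vertices D, ∃ T ∈ M, v ∈ T) : delta D ≤ M.card :=
  Nat.sInf_le ⟨M, ⟨hM, fun _ hM' => Finset.card_le_card fun v hv =>
    Finset.mem_biUnion.mpr (hcov v (hM'.mem_vertices_of_mem_biUnion hv))⟩, rfl⟩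

theorem delta_le_card_of_cover {U : Finset β} {C : β → Finset V}
    (hC : ∀ b ∈ U, (C b).Nonempty → C b ∈ D.faces)
    (hcov : ∀ v ∈ vertices D, ∃ b ∈ U, v ∈ C b) : delta D ≤ U.card := by
  classical
  choose b hbU hbC using hcov
  -- Assigning each vertex to one simplex that contains it makes the cover disjoint.
  let T (c : β) : Finset V := {v | ∃ hv : v ∈ vertices D, b v hv = c}
  have mem_T {c : β} {v : V} : v ∈ T c ↔ ∃ hv : v ∈ vertices D, b v hv = c :=
    Finset.mem_filter_univ v
  have hTC (c : β) : T c ⊆ C c := fun v hv => by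
    obtain ⟨hvD, rfl⟩ := mem_T.mp hv
    exact hbC v hvD
  let M : Finset (Finset V) := {S ∈ U.image T | S.Nonempty}
  have hM : IsMatching D M := by
    constructor
    · intro S hS
      obtain ⟨hS, hne⟩ := Finset.mem_filter.mp hS
      obtain ⟨c, hc, rfl⟩ := Finset.mem_image.mp hS
      exact (D.isRelLowerSet_faces (hC c hc (hne.mono (hTC c)))).2 (hTC c) hne
    · intro S hS S' hS' hne
      obtain ⟨c, -, rfl⟩ := Finset.mem_image.mp (Finset.mem_filter.mp hS).1
      obtain ⟨c', -, rfl⟩ := Finset.mem_image.mp (Finset.mem_filter.mp hS').1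
      refine Finset.disjoint_left.mpr fun v hv hv' => hne ?_
      rw [← (mem_T.mp hv).choose_spec, (mem_T.mp hv').choose_spec]
  have hMcov : ∀ v ∈ vertices D, ∃ S ∈ M, v ∈ S := fun v hv =>
    have hvT : v ∈ T (b v hv) := mem_T.mpr ⟨hv, rfl⟩
    ⟨T (b v hv), Finset.mem_filter.mpr ⟨Finset.mem_image_of_mem T (hbU v hv), v, hvT⟩, hvT⟩
  calc delta D ≤ M.card := delta_le_card_of_isMatching hM hMcov
    _ ≤ (U.image T).card := Finset.card_filter_le _ _
    _ ≤ U.card := Finset.card_image_le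

end Matchings

section LowerBounds

variable {n m q t : ℕ} {A : Fin n → Fin m → ℤ} {B : Fin n → Fin q → ℤ} {r : Fin t → Fin m → ℤ}
  {K : Type*} [Field K] {κ : Type*} [Fintype κ] {P : κ → MvPolynomial (Fin n) K}

theorem card_vertices_le_card_monomials (hr : IsExtremeVectors A r)
    (hP : ∀ E, IsMinimalNonFace A r E → ∃ i, ∃ w ∈ (P i).support, IsInteriorMonomial A r E w) :
    (vertices (complexD A B r)).ncard ≤ (Finset.univ.biUnion fun i => (P i).support).card := by
  classical
  rw [vertices_complexD, Set.ncard_eq_toFinset_card _ (Set.toFinite _)]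
  refine Finset.card_le_card_of_forall_subsingleton (IsInteriorMonomial A r) ?_ ?_
  · intro E hE
    obtain ⟨i, w, hw, hint⟩ := hP E (by simpa using hE)
    exact ⟨w, Finset.mem_biUnion.mpr ⟨i, Finset.mem_univ i, hw⟩, hint⟩
  · rintro w - E ⟨hE, hw⟩ E' ⟨hE', hw'⟩
    exact hw.unique hw' (by simpa using hE) (by simpa using hE') hr

variable {F : Type*} [AddCommGroup F] {f : Fin n → F}

theorem mem_faces_complexD_of_weight_eq (hAB : relationLattice A ≤ relationLattice B)
    (hfB : relationLattice f ≤ relationLattice B) {d : F} {T : Finset (Finset (Fin t))}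
    (hne : T.Nonempty) (hT : ∀ E ∈ T, IsMinimalNonFace A r E ∧
      ∃ w, Finsupp.weight f w = d ∧ IsInteriorMonomial A r E w) :
    T ∈ (complexD A B r).faces := by
  obtain ⟨E₀, hE₀⟩ := id hne
  obtain ⟨-, w₀, hw₀, -⟩ := hT E₀ hE₀
  refine ⟨hne, fun E hE => (hT E hE).1, Finsupp.weight (fun i => toRat (B i)) w₀,
    Set.mem_iInter₂.mpr fun E hE => ?_⟩
  obtain ⟨-, w, hw, hint⟩ := hT E hE
  have hB : Finsupp.weight B w₀ = Finsupp.weight B w :=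
    weight_eq_of_relationLattice_le hfB (hw₀.trans hw.symm)
  rw [weight_toRat, hB, ← weight_toRat]
  exact hint.weight_mem_relintCone_coneProjection hAB

theorem delta_le_sum_numComponents (hAB : relationLattice A ≤ relationLattice B)
    (hfB : relationLattice f ≤ relationLattice B)
    (hP : ∀ E, IsMinimalNonFace A r E → ∃ i, ∃ w ∈ (P i).support, IsInteriorMonomial A r E w) :
    delta (complexD A B r) ≤ ∑ i, numComponents f (P i) := by
  classical
  have hfin (i : κ) : {d | weightedHomogeneousComponent f d (P i) ≠ 0}.Finite :=
    weightedHomogeneousComponent_finsupp (P i)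
  let C (b : Σ _ : κ, F) : Finset (Finset (Fin t)) := {E | IsMinimalNonFace A r E ∧
    ∃ w ∈ (P b.1).support, Finsupp.weight f w = b.2 ∧ IsInteriorMonomial A r E w}
  calc delta (complexD A B r) ≤ (Finset.univ.sigma fun i => (hfin i).toFinset).card := by
        refine delta_le_card_of_cover (C := C) (fun b _ hne => ?_) (fun E hE => ?_)
        · refine mem_faces_complexD_of_weight_eq hAB hfB (d := b.2) hne fun E hE => ?_
          obtain ⟨hE, w, -, hw⟩ := (Finset.mem_filter.mp hE).2
          exact ⟨hE, w, hw⟩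
        · rw [vertices_complexD] at hE
          obtain ⟨i, w, hw, hint⟩ := hP E hE
          refine ⟨⟨i, Finsupp.weight f w⟩, Finset.mem_sigma.mpr ⟨Finset.mem_univ i, ?_⟩,
            Finset.mem_filter.mpr ⟨Finset.mem_univ E, hE, w, hw, rfl, hint⟩⟩
          exact (hfin i).mem_toFinset.mpr (component_weight_ne_zero f hw)
    _ = ∑ i, numComponents f (P i) := by
        rw [Finset.card_sigma]
        exact Finset.sum_congr rfl fun i _ => (Set.ncard_eq_toFinset_card _ (hfin i)).symm

end LowerBounds

theorem theorem3p11_general {K : Type*} [Field K] {n : ℕ} {𝒢 ℱ : Type*} [AddCommGroup 𝒢]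
    [AddCommGroup ℱ] {g : Fin n → 𝒢} {f : Fin n → ℱ} (hspec : IsSpecialization K f g) {m q : ℕ}
    {A : Fin n → Fin m → ℤ}
    (hA : saturation (relationLattice g) = (relationLattice A : Set (Fin n → ℤ)))
    {B : Fin n → Fin q → ℤ}
    (hB : saturation (relationLattice f) = (relationLattice B : Set (Fin n → ℤ)))
    {t : ℕ} {r : Fin t → Fin m → ℤ} (hr : IsExtremeVectors A r) {κ : Type*} [Fintype κ]
    {P : κ → MvPolynomial (Fin n) K}
    (hP : (Ideal.span (Set.range P)).radical = (latticeIdeal K (relationLattice g)).radical) :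
    (vertices (complexD A A r)).ncard ≤ (Finset.univ.biUnion fun i => (P i).support).card ∧
      delta (complexD A B r) ≤ ∑ i, numComponents f (P i) := by
  have hint : ∀ E, IsMinimalNonFace A r E →
      ∃ i, ∃ w ∈ (P i).support, IsInteriorMonomial A r E w :=
    fun _ => exists_isInteriorMonomial hA hr hP
  have hAB : relationLattice A ≤ relationLattice B :=
    hA.symm.subset.trans ((saturation_mono hspec.relationLattice_le).trans hB.subset)
  have hfB : relationLattice f ≤ relationLattice B := (subset_saturation _).trans hB.subset
  exact ⟨card_vertices_le_card_monomials hr hint, delta_le_sum_numComponents hAB hfB hint⟩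

end LatticeIdeal

open LatticeIdeal in
theorem theorem3p11 {K : Type*} [Field K] {n : ℕ}
    {𝒢 ℱ : Type*} [AddCommGroup 𝒢] [AddCommGroup ℱ]
    -- the groups with their distinguished generators; the first grading is positive
    (g : Fin n → 𝒢) (hg : AddSubgroup.closure (Set.range g) = ⊤)
    (f : Fin n → ℱ) (hf : AddSubgroup.closure (Set.range f) = ⊤)
    (hpos : IsPositiveGrading g) (hspec : IsSpecialization K f g)
    -- any vector configurations that define the cones of the two groups
    {m q : ℕ} (A : Fin n → Fin m → ℤ)
    (hA : saturation (relationLattice g) = (relationLattice A : Set (Fin n → ℤ)))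
    (B : Fin n → Fin q → ℤ)
    (hB : saturation (relationLattice f) = (relationLattice B : Set (Fin n → ℤ)))
    -- any choice of extreme vectors of the first cone
    {t : ℕ} (r : Fin t → Fin m → ℤ) (hr : IsExtremeVectors A r)
    {s : ℕ} (P : Fin s → MvPolynomial (Fin n) K)
    (hP : (Ideal.span (Set.range P)).radical = (latticeIdeal K (relationLattice g)).radical) :
    (vertices (complexD A A r)).ncard ≤ (Finset.univ.biUnion fun i => (P i).support).card ∧
      delta (complexD A B r) ≤ ∑ i, numComponents f (P i) :=
  theorem3p11_general hspec hA hB hr hP
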